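/- Let $H$ be a finite bipartite graph with a fixed bipartition $A\cup B$, each edge written as an ordered pair $(u,v)$ with $u\in A$, $v\in B$, and let $e(H)$ be its number of edges. Let $\mathcal F_{\mathbb R}$ and $\mathcal F_{\mathbb C}$ be the real, respectively complex, vector spaces of bounded measurable functions on $[0,1]^2$ with values in $\mathbb R$, respectively $\mathbb C$, where functions that agree almost everywhere are identified when speaking of a norm. For $f\in\mathcal F_{\mathbb R}$ put $$t_H(f)=\int_{[0,1]^{V(H)}}\prod_{(u,v)\in E(H)} f(x_u,x_v)\,dx,$$ and for $f\in\mathcal F_{\mathbb C}$ and a 2-edge-colouring $\alpha:E(H)\to\{0,1\}$ put $$t_{H,\alpha}(f)=\int_{[0,1]^{V(H)}}\ \prod_{(u,v)\in E(H),\ \alpha(u,v)=1} f(x_u,x_v)\prod_{(u,v)\in E(H),\ \alpha(u,v)=0}\overline{f(x_u,x_v)}\,dx,\qquad s_H(f)=\max_\alpha|t_{H,\alpha}(f)|.$$ Call $H$ *real-norming* if $|t_H(\cdot)|^{1/e(H)}$ is a norm on $\mathcal F_{\mathbb R}$, and *complex-norming* if there is a 2-edge-colouring $\alpha$ such that $|t_{H,\alpha}(\cdot)|^{1/e(H)}$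 is a norm on $\mathcal F_{\mathbb C}$. (If $e(H)=0$, read $1/e(H)$ as $0$; then none of these functionals is a norm.) Then $H$ is complex-norming if and only if it is real-norming. More strongly, the following are equivalent: (i) $H$ is real-norming; (ii) $s_H(\cdot)^{1/e(H)}$ is a norm on $\mathcal F_{\mathbb C}$; (iii) $H$ is complex-norming. -/

import Mathlib

open MeasureTheory unitInterval

noncomputable section

namespace GraphNorm

/-- The vector space over `𝕜` (the real or the complex numbers) of all bounded measurable functions
`f : [0,1]² → 𝕜`. -/
def BddMeas (𝕜 : Type*) [RCLike 𝕜] : Submodule 𝕜 (I × I → 𝕜) where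
  carrier := {f | Measurable f ∧ ∃ C : ℝ, ∀ z, ‖f z‖ ≤ C}
  zero_mem' := ⟨measurable_const, 0, fun z => by simp⟩
  add_mem' := by
    rintro f g ⟨hf, C, hC⟩ ⟨hg, D, hD⟩
    exact ⟨hf.add hg, C + D, fun z => (norm_add_le _ _).trans (add_le_add (hC z) (hD z))⟩
  smul_mem' := by
    rintro c f ⟨hf, C, hC⟩
    refine ⟨hf.const_smul c, ‖c‖ * C, fun z => ?_⟩
    rw [Pi.smul_apply, norm_smul]
    exact mul_le_mul_of_nonneg_left (hC z) (norm_nonneg c)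

/-- `N` is a norm on the `𝕜`-vector space of bounded measurable functions on `[0,1]²`, where, as
usual, functions that agree Lebesgue-almost everywhere are identified. -/
structure IsNorm (𝕜 : Type*) [RCLike 𝕜] (N : BddMeas 𝕜 → ℝ) : Prop where
  add_le : ∀ f g : BddMeas 𝕜, N (f + g) ≤ N f + N g
  smul_eq : ∀ (c : 𝕜) (f : BddMeas 𝕜), N (c • f) = ‖c‖ * N f
  eq_zero_iff : ∀ f : BddMeas 𝕜, N f = 0 ↔ (f : I × I → 𝕜) =ᵐ[volume] 0

variable {V : Type*} [Fintype V] [DecidableEq V] (H : SimpleGraph V) [DecidableRel H.Adj]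
  (A : Finset V)

/-- The edges of `H` oriented so that they start in `A`. If `H` is bipartite with parts `A` and `B`,
every edge of `H` occurs here exactly once, as a pair `(u, v)` with `u ∈ A` and `v ∈ B`. -/
def orientedEdges : Finset H.Dart :=
  Finset.univ.filter fun d => d.fst ∈ A

/-- `t_H(f)`, the integral over `[0,1]^V` of the product of `f (x_u, x_v)` over the edges `(u, v)`
of `H`, oriented away from `A`, for real-valued `f`. -/
def realDensity (f : I × I → ℝ) : ℝ :=
  ∫ x : V → I, ∏ d ∈ orientedEdges H A, f (x d.fst, x d.snd)

/-- `t_{H,α}(f)` for complex-valued `f` and a 2-edge-colouring `α`: as `t_H(f)`, where edges of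
colour `1` (`true`) contribute `f`, and edges of colour `0` (`false`) contribute the complex
conjugate of `f`. -/
def colouredDensity (α : H.edgeSet → Bool) (f : I × I → ℂ) : ℂ :=
  ∫ x : V → I, ∏ d ∈ orientedEdges H A,
    if α ⟨d.edge, d.edge_mem⟩ = true then f (x d.fst, x d.snd)
    else (starRingEnd ℂ) (f (x d.fst, x d.snd))

/-- `s_H(f)`, the maximum of `|t_{H,α}(f)|` over the (finitely many) 2-edge-colourings `α`. -/
def maxDensity (f : I × I → ℂ) : ℝ :=
  ⨆ α : H.edgeSet → Bool, ‖colouredDensity H A α f‖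

/-- `H` is real-norming: `|t_H(·)|^{1/e(H)}` is a norm on the real-valued functions. -/
def RealNorming : Prop :=
  IsNorm ℝ fun f => |realDensity H A f| ^ (1 / (H.edgeFinset.card : ℝ))

/-- The 2-coloured graph `(H, α)` is complex-norming: `|t_{H,α}(·)|^{1/e(H)}` is a norm on the
complex-valued functions. -/
def ColouredComplexNorming (α : H.edgeSet → Bool) : Prop :=
  IsNorm ℂ fun f => ‖colouredDensity H A α f‖ ^ (1 / (H.edgeFinset.card : ℝ))

/-- `H` is complex-norming: some 2-edge-colouring makes it so. -/
def ComplexNorming : Prop :=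
  ∃ α : H.edgeSet → Bool, ColouredComplexNorming H A α

/-- `s_H(·)^{1/e(H)}` is a norm on the complex-valued functions. -/
def MaxNorming : Prop :=
  IsNorm ℂ fun f => maxDensity H A f ^ (1 / (H.edgeFinset.card : ℝ))

end GraphNorm

end

/-! Complex to real is restriction: on real functions colours are invisible. For the converse, let H
be real-norming with m edges. The tool is the tensor power trick. Expanding t_H of 2 Re (f ⊗ conj
f)^{⊗k} edge by edge gives the sum of |t_{H,α}(f)|^{2k} over all colourings α, with no cancellation.
If s_H(f) ≤ 1, its real norm is therefore at most 2 for every k. Adding such functions for f_1, ...,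
f_m and using the triangle inequality bounds |t_H(f_1, ..., f_m)|^{2k} by (2m)^m; letting k grow
gives a Hölder inequality for s_H (`norm_density_le_prod_supNorm`), and so the triangle inequality.

Hölder also makes s_H multiplicative on tensor products (`supDensity_tensor`). If each colouring
fell short of the maximum at some function, the tensor product of these functions would have no
maximising colouring. So one colouring attains s_H everywhere, and it is norming. -/

open MeasureTheory unitInterval

noncomputable section

namespace GraphNorm

/-! ### Conjugation, real parts and tensor products -/

/-- The pointwise complex conjugate. -/
def conj (f : BddMeas ℂ) : BddMeas ℂ :=
  ⟨fun z => (starRingEnd ℂ) (f.1 z), by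
    obtain ⟨hf, C, hC⟩ := f.2
    exact ⟨Complex.continuous_conj.measurable.comp hf, C, fun z => by simpa using hC z⟩⟩

/-- A real-valued function, regarded as complex-valued. -/
def ofReal (f : BddMeas ℝ) : BddMeas ℂ :=
  ⟨fun z => (f.1 z : ℂ), by
    obtain ⟨hf, C, hC⟩ := f.2
    exact ⟨Complex.measurable_ofReal.comp hf, C, fun z => by simpa using hC z⟩⟩

/-- The pointwise real part. -/
def re (f : BddMeas ℂ) : BddMeas ℝ :=
  ⟨fun z => (f.1 z).re, by
    obtain ⟨hf, C, hC⟩ := f.2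
    exact ⟨Complex.measurable_re.comp hf, C, fun z => (Complex.abs_re_le_norm _).trans (hC z)⟩⟩

/-- The constant function `1`. -/
def one : BddMeas ℂ := ⟨fun _ => 1, measurable_const, 1, fun z => by simp⟩

/-- A measurable map from `[0,1]` to `[0,1]²` that transports the uniform measure to the uniform
measure. -/
def split : I → I × I :=
  (Measure.exists_measurable_map_eq (volume : Measure (I × I))).choose

theorem measurePreserving_split : MeasurePreserving split volume volume :=
  ⟨(Measure.exists_measurable_map_eq (volume : Measure (I × I))).choose_spec.1,
    (Measure.exists_measurable_map_eq (volume : Measure (I × I))).choose_spec.2⟩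

theorem measurable_split : Measurable split := measurePreserving_split.measurable

/-- The tensor product of two functions on `[0,1]²`, transported from `([0,1]²)²` to `[0,1]²`. -/
def tensor (f g : BddMeas ℂ) : BddMeas ℂ :=
  ⟨fun z => f.1 ((split z.1).1, (split z.2).1) * g.1 ((split z.1).2, (split z.2).2), by
    obtain ⟨hf, C, hC⟩ := f.2
    obtain ⟨hg, D, hD⟩ := g.2
    have hm := measurable_split
    refine ⟨(hf.comp (by fun_prop)).mul (hg.comp (by fun_prop)), C * D, fun z => ?_⟩
    rw [norm_mul]
    exact mul_le_mul (hC _) (hD _) (norm_nonneg _) ((norm_nonneg _).trans (hC (0, 0)))⟩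

/-- The function itself for `true`, its complex conjugate for `false`. -/
def colour (b : Bool) (f : BddMeas ℂ) : BddMeas ℂ := if b = true then f else conj f

/-- The tensor power with `n + 1` factors. -/
def tensorPow (f : BddMeas ℂ) : ℕ → BddMeas ℂ
  | 0 => f
  | n + 1 => tensor (tensorPow f n) f

theorem conj_conj (f : BddMeas ℂ) : conj (conj f) = f :=
  Subtype.ext (funext fun z => by simp [conj])

theorem conj_add (f g : BddMeas ℂ) : conj (f + g) = conj f + conj g :=
  Subtype.ext (funext fun z => by simp [conj])

theorem conj_smul (c : ℂ) (f : BddMeas ℂ) : conj (c • f) = (starRingEnd ℂ) c • conj f :=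
  Subtype.ext (funext fun z => by simp [conj])

theorem conj_ofReal (f : BddMeas ℝ) : conj (ofReal f) = ofReal f :=
  Subtype.ext (funext fun z => by simp [conj, ofReal])

theorem conj_one : conj one = one := Subtype.ext (funext fun z => by simp [conj, one])

theorem conj_tensor (f g : BddMeas ℂ) : conj (tensor f g) = tensor (conj f) (conj g) :=
  Subtype.ext (funext fun z => by simp [conj, tensor])

theorem conj_tensorPow (f : BddMeas ℂ) (n : ℕ) : conj (tensorPow f n) = tensorPow (conj f) n := by
  induction n with
  | zero => rfl
  | succ n ih => simp only [tensorPow, conj_tensor, ih]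

theorem ofReal_add (f g : BddMeas ℝ) : ofReal (f + g) = ofReal f + ofReal g :=
  Subtype.ext (funext fun z => by simp [ofReal])

theorem ofReal_smul (c : ℝ) (f : BddMeas ℝ) : ofReal (c • f) = (c : ℂ) • ofReal f :=
  Subtype.ext (funext fun z => by simp [ofReal])

theorem ofReal_zero : ofReal 0 = 0 :=
  Subtype.ext (funext fun z => by simp [ofReal])

theorem ofReal_sum {κ : Type*} (S : Finset κ) (f : κ → BddMeas ℝ) :
    ofReal (∑ i ∈ S, f i) = ∑ i ∈ S, ofReal (f i) := by
  classical
  induction S using Finset.induction_on with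
  | empty => simp [ofReal_zero]
  | insert a S ha ih => rw [Finset.sum_insert ha, Finset.sum_insert ha, ofReal_add, ih]

theorem ofReal_re_add_re (f : BddMeas ℂ) : ofReal (re f + re f) = f + conj f := by
  refine Subtype.ext (funext fun z => ?_)
  apply Complex.ext <;> simp [ofReal, conj, re]

theorem colour_true (f : BddMeas ℂ) : colour true f = f := rfl

theorem colour_false (f : BddMeas ℂ) : colour false f = conj f := rfl

theorem colour_not (b : Bool) (f : BddMeas ℂ) : colour (!b) f = conj (colour b f) := by
  cases b <;> simp [colour_true, colour_false, conj_conj]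

theorem colour_add (b : Bool) (f g : BddMeas ℂ) :
    colour b (f + g) = colour b f + colour b g := by
  cases b <;> simp [colour_true, colour_false, conj_add]

theorem colour_ofReal (b : Bool) (f : BddMeas ℝ) : colour b (ofReal f) = ofReal f := by
  cases b <;> simp [colour_true, colour_false, conj_ofReal]

theorem colour_one (b : Bool) : colour b one = one := by
  cases b <;> simp [colour_true, colour_false, conj_one]

theorem colour_tensor (b : Bool) (f g : BddMeas ℂ) :
    colour b (tensor f g) = tensor (colour b f) (colour b g) := by
  cases b <;> simp [colour_true, colour_false, conj_tensor]

theorem colour_smul (b : Bool) (c : ℂ) (f : BddMeas ℂ) :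
    colour b (c • f) = (if b = true then c else (starRingEnd ℂ) c) • colour b f := by
  cases b <;> simp [colour_true, colour_false, conj_smul]

/-! ### Multilinear densities and their maximum over colourings -/

section Density

variable {V ι : Type*} [Fintype V] [Fintype ι] (s t : ι → V)

/-- The multilinear homomorphism density of a family of functions indexed by the edges of a
directed multigraph with source map `s` and target map `t`. -/
def density (F : ι → BddMeas ℂ) : ℂ :=
  ∫ x : V → I, ∏ i, (F i).1 (x (s i), x (t i))

theorem integrable_prod (F : ι → BddMeas ℂ) :
    Integrable fun x : V → I => ∏ i, (F i).1 (x (s i), x (t i)) := by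
  have hm : ∀ i, Measurable fun x : V → I => (F i).1 (x (s i), x (t i)) := fun i =>
    (F i).2.1.comp (by fun_prop)
  choose C hC using fun i => (F i).2.2
  refine Integrable.of_bound (C := ∏ i, C i)
    (Finset.measurable_prod _ fun i _ => hm i).aestronglyMeasurable (.of_forall fun x => ?_)
  rw [norm_prod]
  exact Finset.prod_le_prod (fun i _ => norm_nonneg _) fun i _ => hC i _

theorem density_sum {κ : Type*} [Fintype κ] (F : ι → κ → BddMeas ℂ) [DecidableEq ι] :
    density s t (fun i => ∑ j, F i j) = ∑ p : ι → κ, density s t fun i => F i (p i) := by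
  unfold density
  rw [← integral_finsetSum _ fun p _ => integrable_prod s t fun i => F i (p i)]
  refine integral_congr_ae (.of_forall fun x => ?_)
  have h : ∀ i, (∑ j, F i j : BddMeas ℂ).1 (x (s i), x (t i)) =
      ∑ j, (F i j).1 (x (s i), x (t i)) := fun i => by
    rw [← Submodule.subtype_apply, map_sum, Finset.sum_apply]
    rfl
  simp only [h]
  rw [Finset.prod_univ_sum, Fintype.piFinset_univ]

theorem density_smul (c : ι → ℂ) (F : ι → BddMeas ℂ) :
    density s t (fun i => c i • F i) = (∏ i, c i) * density s t F := by
  unfold density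
  rw [← integral_const_mul]
  refine integral_congr_ae (.of_forall fun x => ?_)
  simp [Finset.prod_mul_distrib]

theorem density_conj (F : ι → BddMeas ℂ) :
    density s t (fun i => conj (F i)) = (starRingEnd ℂ) (density s t F) := by
  unfold density
  rw [← integral_conj]
  simp [conj, map_prod]

theorem density_one : density s t (fun _ => one) = 1 := by
  simp [density, one]

theorem measurePreserving_split_pi :
    MeasurePreserving (fun x : V → I => ((fun v => (split (x v)).1), fun v => (split (x v)).2))
      volume volume := by
  have h1 : MeasurePreserving (fun (x : V → I) v => split (x v)) volume volume :=
    volume_preserving_pi fun _ => measurePreserving_split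
  exact (volume_measurePreserving_arrowProdEquivProdArrow I I V).comp h1

/-- Applying `split` at every vertex carries the measure on [0,1]^V to the product measure on two
copies of it, where the integrand separates. -/
theorem density_tensor (F G : ι → BddMeas ℂ) :
    density s t (fun i => tensor (F i) (G i)) = density s t F * density s t G := by
  unfold density
  rw [← integral_prod_mul (μ := (volume : Measure (V → I))) (ν := (volume : Measure (V → I))),
    ← Measure.volume_eq_prod, ← (measurePreserving_split_pi (V := V)).map_eq, integral_map]
  · simp [tensor, Finset.prod_mul_distrib]
  · exact measurePreserving_split_pi.aemeasurable
  · rw [measurePreserving_split_pi.map_eq]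
    exact ((integrable_prod s t F).mul_prod (integrable_prod s t G)).aestronglyMeasurable

theorem density_tensorPow (F : ι → BddMeas ℂ) (n : ℕ) :
    density s t (fun i => tensorPow (F i) n) = density s t F ^ (n + 1) := by
  induction n with
  | zero => simp [tensorPow]
  | succ n ih => simp only [tensorPow, density_tensor, ih, pow_succ]

/-- The tensor power with `n + 1` factors of `f ⊗ conj f`. -/
def sqPow (n : ℕ) (f : BddMeas ℂ) : BddMeas ℂ := tensorPow (tensor f (conj f)) n

theorem conj_sqPow (n : ℕ) (f : BddMeas ℂ) : conj (sqPow n f) = sqPow n (conj f) := by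
  simp only [sqPow, conj_tensorPow, conj_tensor]

theorem density_sqPow (F : ι → BddMeas ℂ) (n : ℕ) :
    density s t (fun i => sqPow n (F i)) = (((‖density s t F‖ ^ 2) ^ (n + 1) : ℝ) : ℂ) := by
  unfold sqPow
  rw [density_tensorPow, density_tensor, density_conj, Complex.mul_conj, Complex.normSq_eq_norm_sq]
  push_cast
  rfl

/-- A real-valued function which equals `2 Re (f ⊗ conj f)^{⊗(n+1)}`. -/
def realSqPow (n : ℕ) (f : BddMeas ℂ) : BddMeas ℝ := re (sqPow n f) + re (sqPow n f)

theorem ofReal_realSqPow (n : ℕ) (f : BddMeas ℂ) :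
    ofReal (realSqPow n f) = ∑ b : Bool, sqPow n (colour b f) := by
  rw [realSqPow, ofReal_re_add_re, Fintype.sum_bool, colour_true, colour_false, conj_sqPow]

/-- Choosing one of the two conjugate summands on each edge amounts to choosing a colouring. The
factor f ⊗ conj f makes every term a nonnegative real, so single terms can be bounded by the sum. -/
theorem density_realSqPow [DecidableEq ι] (F : ι → BddMeas ℂ) (n : ℕ) :
    density s t (fun i => ofReal (realSqPow n (F i))) =
      ((∑ c : ι → Bool, (‖density s t fun i => colour (c i) (F i)‖ ^ 2) ^ (n + 1) : ℝ) : ℂ) := by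
  simp only [ofReal_realSqPow]
  rw [density_sum, Complex.ofReal_sum]
  exact Finset.sum_congr rfl fun c _ => density_sqPow s t (fun i => colour (c i) (F i)) n

theorem density_sum_realSqPow [DecidableEq ι] (F : ι → BddMeas ℂ) (n : ℕ) :
    density s t (fun _ => ofReal (∑ i, realSqPow n (F i))) =
      ((∑ p : ι → ι × Bool,
        (‖density s t fun i => colour (p i).2 (F (p i).1)‖ ^ 2) ^ (n + 1) : ℝ) : ℂ) := by
  simp only [ofReal_sum, ofReal_realSqPow]
  have h : ∑ i, ∑ b : Bool, sqPow n (colour b (F i)) =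
      ∑ q : ι × Bool, sqPow n (colour q.2 (F q.1)) :=
    (Fintype.sum_prod_type fun q : ι × Bool => sqPow n (colour q.2 (F q.1))).symm
  rw [h, density_sum, Complex.ofReal_sum]
  exact Finset.sum_congr rfl fun p _ =>
    density_sqPow s t (fun i => colour (p i).2 (F (p i).1)) n

/-- The largest modulus of a coloured density of `f`, over all 2-edge-colourings. -/
def supDensity (f : BddMeas ℂ) : ℝ :=
  ⨆ c : ι → Bool, ‖density s t fun i => colour (c i) f‖

theorem le_supDensity (c : ι → Bool) (f : BddMeas ℂ) :
    ‖density s t fun i => colour (c i) f‖ ≤ supDensity s t f :=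
  le_ciSup (f := fun c : ι → Bool => ‖density s t fun i => colour (c i) f‖)
    (Set.finite_range _).bddAbove c

theorem exists_eq_supDensity (f : BddMeas ℂ) :
    ∃ c : ι → Bool, ‖density s t fun i => colour (c i) f‖ = supDensity s t f :=
  exists_eq_ciSup_of_finite

theorem supDensity_nonneg (f : BddMeas ℂ) : 0 ≤ supDensity s t f :=
  (norm_nonneg _).trans (le_supDensity s t (fun _ => true) f)

theorem supDensity_conj (f : BddMeas ℂ) : supDensity s t (conj f) = supDensity s t f := by
  have h : ∀ f, supDensity s t (conj f) ≤ supDensity s t f := fun f => by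
    obtain ⟨c, hc⟩ := exists_eq_supDensity s t (conj f)
    rw [← hc]
    have := le_supDensity s t (fun i => !(c i)) f
    simp only [colour_not] at this
    refine le_of_eq_of_le ?_ this
    congr 2
    funext i
    cases c i <;> simp [colour_true, colour_false]
  refine (h f).antisymm ?_
  simpa only [conj_conj] using h (conj f)

theorem supDensity_colour (b : Bool) (f : BddMeas ℂ) :
    supDensity s t (colour b f) = supDensity s t f := by
  cases b <;> simp [colour_true, colour_false, supDensity_conj]

theorem norm_density_colour_smul (a : ι → Bool) (c : ℂ) (f : BddMeas ℂ) :
    ‖density s t fun i => colour (a i) (c • f)‖ =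
      ‖c‖ ^ Fintype.card ι * ‖density s t fun i => colour (a i) f‖ := by
  simp only [colour_smul]
  rw [density_smul, norm_mul, norm_prod]
  congr 1
  rw [Fintype.card, ← Finset.prod_const]
  refine Finset.prod_congr rfl fun i _ => ?_
  split_ifs <;> simp

theorem supDensity_smul (c : ℂ) (f : BddMeas ℂ) :
    supDensity s t (c • f) = ‖c‖ ^ Fintype.card ι * supDensity s t f := by
  unfold supDensity
  rw [Real.mul_iSup_of_nonneg (by positivity)]
  simp only [norm_density_colour_smul]

theorem supDensity_ofReal (f : BddMeas ℝ) :
    supDensity s t (ofReal f) = ‖density s t fun _ => ofReal f‖ := by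
  simp [supDensity, colour_ofReal]

theorem supDensity_tensor_le (f g : BddMeas ℂ) :
    supDensity s t (tensor f g) ≤ supDensity s t f * supDensity s t g := by
  obtain ⟨c, hc⟩ := exists_eq_supDensity s t (tensor f g)
  rw [← hc]
  simp only [colour_tensor]
  rw [density_tensor, norm_mul]
  exact mul_le_mul (le_supDensity s t c f) (le_supDensity s t c g) (norm_nonneg _)
    (supDensity_nonneg s t f)

end Density

/-! ### The functionals and their homogeneity -/

section Norm

variable {V ι : Type*} [Fintype V] [Fintype ι] (s t : ι → V)

/-- The functional `|t(f)|^{1/m}` on real-valued functions, where `m` is the number of edges. -/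
def realNorm (f : BddMeas ℝ) : ℝ := ‖density s t fun _ => ofReal f‖ ^ (1 / (Fintype.card ι : ℝ))

/-- The functional `s(f)^{1/m}` on complex-valued functions, where `m` is the number of edges. -/
def supNorm (f : BddMeas ℂ) : ℝ := supDensity s t f ^ (1 / (Fintype.card ι : ℝ))

theorem IsNorm.map_zero {𝕜 : Type*} [RCLike 𝕜] {N : BddMeas 𝕜 → ℝ} (hN : IsNorm 𝕜 N) : N 0 = 0 :=
  (hN.eq_zero_iff 0).2 (by rfl)

theorem IsNorm.sum_le {𝕜 κ : Type*} [RCLike 𝕜] {N : BddMeas 𝕜 → ℝ} (hN : IsNorm 𝕜 N)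
    (S : Finset κ) (f : κ → BddMeas 𝕜) : N (∑ i ∈ S, f i) ≤ ∑ i ∈ S, N (f i) :=
  Finset.le_sum_of_subadditive N hN.map_zero.le hN.add_le S f

/-- Without edges the exponent is 1 / 0 = 0, so the functional is constantly 1, even at 0. -/
theorem card_pos_of_isNorm_rpow {𝕜 ι : Type*} [RCLike 𝕜] [Fintype ι] {D : BddMeas 𝕜 → ℝ}
    (hN : IsNorm 𝕜 fun f => D f ^ (1 / (Fintype.card ι : ℝ))) : 0 < Fintype.card ι := by
  by_contra h
  have h0 : Fintype.card ι = 0 := by omega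
  have := hN.map_zero
  simp [h0] at this

theorem realNorm_pow (hm : 0 < Fintype.card ι) (f : BddMeas ℝ) :
    realNorm s t f ^ Fintype.card ι = ‖density s t fun _ => ofReal f‖ := by
  rw [realNorm, one_div, Real.rpow_inv_natCast_pow (norm_nonneg _) hm.ne']

theorem supNorm_pow (hm : 0 < Fintype.card ι) (f : BddMeas ℂ) :
    supNorm s t f ^ Fintype.card ι = supDensity s t f := by
  rw [supNorm, one_div, Real.rpow_inv_natCast_pow (supDensity_nonneg s t f) hm.ne']

theorem supNorm_nonneg (f : BddMeas ℂ) : 0 ≤ supNorm s t f :=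
  Real.rpow_nonneg (supDensity_nonneg s t f) _

theorem realNorm_nonneg (f : BddMeas ℝ) : 0 ≤ realNorm s t f :=
  Real.rpow_nonneg (norm_nonneg _) _

theorem supNorm_smul (hm : 0 < Fintype.card ι) (c : ℂ) (f : BddMeas ℂ) :
    supNorm s t (c • f) = ‖c‖ * supNorm s t f := by
  rw [supNorm, supDensity_smul, Real.mul_rpow (by positivity) (supDensity_nonneg s t f), one_div,
    Real.pow_rpow_inv_natCast (norm_nonneg c) hm.ne', supNorm, one_div]

theorem supNorm_colour (b : Bool) (f : BddMeas ℂ) : supNorm s t (colour b f) = supNorm s t f := by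
  rw [supNorm, supNorm, supDensity_colour]

theorem supNorm_ofReal (f : BddMeas ℝ) : supNorm s t (ofReal f) = realNorm s t f := by
  rw [supNorm, realNorm, supDensity_ofReal]

theorem supNorm_tensor_le (f g : BddMeas ℂ) :
    supNorm s t (tensor f g) ≤ supNorm s t f * supNorm s t g := by
  rw [supNorm, supNorm, supNorm,
    ← Real.mul_rpow (supDensity_nonneg s t f) (supDensity_nonneg s t g)]
  exact Real.rpow_le_rpow (supDensity_nonneg s t _) (supDensity_tensor_le s t f g) (by positivity)

/-! ### Hölder's inequality by tensor powers -/

theorem le_one_of_forall_pow_le {x C : ℝ} (h : ∀ n : ℕ, x ^ (n + 1) ≤ C) : x ≤ 1 := by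
  by_contra! hx
  obtain ⟨n, hn⟩ := pow_unbounded_of_one_lt C hx
  exact absurd (h n) (not_le.2 (hn.trans_le (pow_le_pow_right₀ hx.le n.le_succ)))

theorem realNorm_realSqPow_le (hm : 0 < Fintype.card ι) {f : BddMeas ℂ}
    (hf : supDensity s t f ≤ 1) (n : ℕ) : realNorm s t (realSqPow n f) ≤ 2 := by
  classical
  refine le_of_pow_le_pow_left₀ hm.ne' (by norm_num) ?_
  rw [realNorm_pow s t hm, density_realSqPow s t fun _ => f, Complex.norm_real, Real.norm_of_nonneg
    (Finset.sum_nonneg fun c _ => by positivity)]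
  calc _ ≤ ∑ _c : ι → Bool, (1 : ℝ) := Finset.sum_le_sum fun c _ =>
        pow_le_one₀ (by positivity) (pow_le_one₀ (norm_nonneg _) ((le_supDensity s t c f).trans hf))
    _ = 2 ^ Fintype.card ι := by simp

/-- The real norm of the sum of all `realSqPow n (F i)` is at most 2m, uniformly in n, while its
density dominates a power of the wanted quantity. -/
theorem norm_density_le_one (hN : IsNorm ℝ (realNorm s t)) {F : ι → BddMeas ℂ}
    (hF : ∀ i, supDensity s t (F i) ≤ 1) : ‖density s t F‖ ≤ 1 := by
  classical
  have hm : 0 < Fintype.card ι := card_pos_of_isNorm_rpow hN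
  have key : ∀ n : ℕ, (‖density s t F‖ ^ 2) ^ (n + 1) ≤
      (Fintype.card ι * 2 : ℝ) ^ Fintype.card ι := fun n => by
    have h1 : realNorm s t (∑ i, realSqPow n (F i)) ≤ Fintype.card ι * 2 :=
      calc _ ≤ ∑ i, realNorm s t (realSqPow n (F i)) := hN.sum_le _ _
        _ ≤ ∑ _i : ι, (2 : ℝ) :=
          Finset.sum_le_sum fun i _ => realNorm_realSqPow_le s t hm (hF i) n
        _ = _ := by simp
    have h2 := pow_le_pow_left₀ (realNorm_nonneg s t _) h1 (Fintype.card ι)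
    rw [realNorm_pow s t hm, density_sum_realSqPow, Complex.norm_real, Real.norm_of_nonneg
      (Finset.sum_nonneg fun c _ => by positivity)] at h2
    refine le_trans ?_ h2
    -- The term that assigns to each edge its own function, unconjugated.
    exact Finset.single_le_sum (f := fun p : ι → ι × Bool =>
      (‖density s t fun i => colour (p i).2 (F (p i).1)‖ ^ 2) ^ (n + 1))
      (fun c _ => by positivity) (Finset.mem_univ fun i => (i, true))
  have := le_one_of_forall_pow_le key
  rwa [sq_le_one_iff₀ (norm_nonneg _)] at this

theorem norm_density_le_prod_of_pos (hN : IsNorm ℝ (realNorm s t)) {F : ι → BddMeas ℂ} {a : ι → ℝ}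
    (ha : ∀ i, 0 < a i) (hF : ∀ i, supNorm s t (F i) ≤ a i) : ‖density s t F‖ ≤ ∏ i, a i := by
  have hm : 0 < Fintype.card ι := card_pos_of_isNorm_rpow hN
  have h := norm_density_le_one s t hN (F := fun i => ((a i)⁻¹ : ℂ) • F i) fun i => by
    rw [← supNorm_pow s t hm, supNorm_smul s t hm, norm_inv, Complex.norm_real,
      Real.norm_of_nonneg (ha i).le]
    refine pow_le_one₀ (mul_nonneg (inv_nonneg.2 (ha i).le) (supNorm_nonneg s t _)) ?_
    rw [inv_mul_le_one₀ (ha i)]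
    exact hF i
  rw [density_smul, norm_mul, norm_prod] at h
  simp only [norm_inv, Complex.norm_real, Real.norm_of_nonneg (ha _).le] at h
  rwa [Finset.prod_inv_distrib, inv_mul_le_one₀ (Finset.prod_pos fun i _ => ha i)] at h

/-- The Hölder inequality for `supNorm`. -/
theorem norm_density_le_prod_supNorm (hN : IsNorm ℝ (realNorm s t)) (F : ι → BddMeas ℂ) :
    ‖density s t F‖ ≤ ∏ i, supNorm s t (F i) := by
  have hlim : Filter.Tendsto (fun ε : ℝ => ∏ i, (supNorm s t (F i) + ε)) (nhdsWithin 0 (Set.Ioi 0))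
      (nhds (∏ i, (supNorm s t (F i) + 0))) :=
    (Continuous.tendsto (by fun_prop) 0).mono_left nhdsWithin_le_nhds
  simp only [add_zero] at hlim
  -- Functions of norm zero cannot be normalised, hence the slack ε.
  refine ge_of_tendsto hlim (eventually_nhdsWithin_of_forall fun ε hε => ?_)
  have hε : 0 < ε := hε
  exact norm_density_le_prod_of_pos s t hN
    (fun i => add_pos_of_nonneg_of_pos (supNorm_nonneg s t _) hε) fun i => by linarith

/-! ### Triangle inequality and definiteness -/

theorem supNorm_add_le (hN : IsNorm ℝ (realNorm s t)) (f g : BddMeas ℂ) :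
    supNorm s t (f + g) ≤ supNorm s t f + supNorm s t g := by
  classical
  have hm : 0 < Fintype.card ι := card_pos_of_isNorm_rpow hN
  refine le_of_pow_le_pow_left₀ hm.ne'
    (add_nonneg (supNorm_nonneg s t f) (supNorm_nonneg s t g)) ?_
  rw [supNorm_pow s t hm]
  obtain ⟨c, hc⟩ := exists_eq_supDensity s t (f + g)
  have hsum : (fun i => colour (c i) (f + g)) =
      fun i => ∑ b : Bool, colour (c i) (if b = true then f else g) := by
    funext i
    simp [colour_add]
  rw [← hc, hsum, density_sum]
  calc _ ≤ ∑ p : ι → Bool, ∏ i, supNorm s t (colour (c i) (if p i = true then f else g)) :=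
        (norm_sum_le _ _).trans (Finset.sum_le_sum fun p _ =>
          norm_density_le_prod_supNorm s t hN _)
    _ = ∏ _i : ι, ∑ b : Bool, supNorm s t (if b = true then f else g) := by
        simp only [supNorm_colour]
        rw [Finset.prod_univ_sum, Fintype.piFinset_univ]
    _ = (supNorm s t f + supNorm s t g) ^ Fintype.card ι := by
        simp [Finset.prod_const]

theorem density_ofReal_re_eq_zero {f : BddMeas ℂ} (hf : supDensity s t f = 0) :
    density s t (fun _ => ofReal (re f + re f)) = 0 := by
  classical
  have h : (fun _ : ι => ofReal (re f + re f)) = fun _ => ∑ b : Bool, colour b f := by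
    funext i
    simp [ofReal_re_add_re, colour_true, colour_false]
  rw [h, density_sum]
  exact Finset.sum_eq_zero fun c _ => norm_le_zero_iff.1 ((le_supDensity s t c f).trans hf.le)

theorem ae_eq_zero_of_supDensity_eq_zero (hN : IsNorm ℝ (realNorm s t)) {f : BddMeas ℂ}
    (hf : supDensity s t f = 0) : (f : I × I → ℂ) =ᵐ[volume] 0 := by
  have hm : 0 < Fintype.card ι := card_pos_of_isNorm_rpow hN
  have key : ∀ g : BddMeas ℂ, supDensity s t g = 0 →
      ∀ᵐ z ∂(volume : Measure (I × I)), (g.1 z).re = 0 := fun g hg => by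
    have h : realNorm s t (re g + re g) = 0 := by
      rw [realNorm, density_ofReal_re_eq_zero s t hg, norm_zero, Real.zero_rpow (by positivity)]
    filter_upwards [(hN.eq_zero_iff _).1 h] with z hz
    have hz : (g.1 z).re + (g.1 z).re = 0 := hz
    linarith
  -- The real part of i f is minus the imaginary part of f.
  have hI := key (Complex.I • f) (by rw [supDensity_smul, hf, mul_zero])
  filter_upwards [key f hf, hI] with z h1 h2
  have h2 : (Complex.I * f.1 z).re = 0 := h2
  exact Complex.ext h1 (by simpa using h2)

theorem realSqPow_zero_ae_eq_zero {f : BddMeas ℂ} (hf : (f : I × I → ℂ) =ᵐ[volume] 0) :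
    (realSqPow 0 f : I × I → ℝ) =ᵐ[volume] 0 := by
  have hp : MeasurePreserving (fun x : I => (split x).1) volume volume :=
    (measurePreserving_fst (μ := (volume : Measure I)) (ν := (volume : Measure I))).comp
      measurePreserving_split
  filter_upwards [(hp.prod hp).quasiMeasurePreserving.ae_eq_comp hf] with z hz
  have hz : f.1 ((split z.1).1, (split z.2).1) = 0 := hz
  have : (realSqPow 0 f).1 z = (f.1 ((split z.1).1, (split z.2).1) * (conj f).1 _).re +
    (f.1 ((split z.1).1, (split z.2).1) * (conj f).1 ((split z.1).2, (split z.2).2)).re := rfl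
  simpa [hz] using this

/-- Loops s i = t i are not excluded, and the diagonal is a null set, so this needs the norm
property: `realSqPow 0 f` vanishes almost everywhere, and its density is a sum of squares of all
coloured densities of f. -/
theorem supDensity_eq_zero_of_ae_eq_zero (hN : IsNorm ℝ (realNorm s t)) {f : BddMeas ℂ}
    (hf : (f : I × I → ℂ) =ᵐ[volume] 0) : supDensity s t f = 0 := by
  classical
  have hm : 0 < Fintype.card ι := card_pos_of_isNorm_rpow hN
  have h := realNorm_pow s t hm (realSqPow 0 f)
  rw [(hN.eq_zero_iff _).2 (realSqPow_zero_ae_eq_zero hf), zero_pow hm.ne',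
    density_realSqPow s t (fun _ => f), Complex.norm_real, eq_comm, norm_eq_zero,
    Finset.sum_eq_zero_iff_of_nonneg fun c _ => by positivity] at h
  obtain ⟨c, hc⟩ := exists_eq_supDensity s t f
  rw [← hc]
  simpa using h c (Finset.mem_univ c)

theorem isNorm_supNorm (hN : IsNorm ℝ (realNorm s t)) : IsNorm ℂ (supNorm s t) where
  add_le := supNorm_add_le s t hN
  smul_eq := supNorm_smul s t (card_pos_of_isNorm_rpow hN)
  eq_zero_iff f := by
    have hm : 0 < Fintype.card ι := card_pos_of_isNorm_rpow hN
    rw [supNorm, Real.rpow_eq_zero (supDensity_nonneg s t f) (by positivity)]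
    exact ⟨ae_eq_zero_of_supDensity_eq_zero s t hN, supDensity_eq_zero_of_ae_eq_zero s t hN⟩

/-! ### Multiplicativity and a universal colouring -/

/-- Hölder is applied to the mixed family of tensors coloured by c and d. At j the colours agree, so
that factor is the norm of f ⊗ g itself; the other m - 1 factors are bounded by submultiplicativity
and cancel. -/
theorem supNorm_mul_le_tensor_of_eq (hN : IsNorm ℝ (realNorm s t)) {f g : BddMeas ℂ}
    (hf : 0 < supNorm s t f) (hg : 0 < supNorm s t g) {c d : ι → Bool} {j : ι} (hj : c j = d j)
    (hc : ‖density s t fun i => colour (c i) f‖ = supDensity s t f)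
    (hd : ‖density s t fun i => colour (d i) g‖ = supDensity s t g) :
    supNorm s t f * supNorm s t g ≤ supNorm s t (tensor f g) := by
  classical
  have hm : 0 < Fintype.card ι := card_pos_of_isNorm_rpow hN
  have hle : ∀ i, supNorm s t (tensor (colour (c i) f) (colour (d i) g)) ≤
      supNorm s t f * supNorm s t g := fun i => by
    simpa only [supNorm_colour] using
      supNorm_tensor_le s t (colour (c i) f) (colour (d i) g)
  have h := norm_density_le_prod_supNorm s t hN
    fun i => tensor (colour (c i) f) (colour (d i) g)
  rw [density_tensor, norm_mul, hc, hd, ← supNorm_pow s t hm f, ← supNorm_pow s t hm g, ← mul_pow,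
    ← Finset.mul_prod_erase _ _ (Finset.mem_univ j), ← hj, ← colour_tensor, supNorm_colour] at h
  have h2 : ∏ i ∈ Finset.univ.erase j, supNorm s t (tensor (colour (c i) f) (colour (d i) g)) ≤
      (supNorm s t f * supNorm s t g) ^ (Fintype.card ι - 1) :=
    (Finset.prod_le_prod (fun i _ => supNorm_nonneg s t _) fun i _ => hle i).trans_eq (by
      rw [Finset.prod_const, Finset.card_erase_of_mem (Finset.mem_univ j), Finset.card_univ])
  have h3 := h.trans (mul_le_mul_of_nonneg_left h2 (supNorm_nonneg s t _))
  rw [← Nat.sub_add_cancel hm, pow_succ', Nat.add_sub_cancel] at h3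
  exact le_of_mul_le_mul_right h3 (by positivity)

/-- `supDensity` is multiplicative on tensor products. -/
theorem supDensity_tensor (hN : IsNorm ℝ (realNorm s t)) {f g : BddMeas ℂ}
    (hf : 0 < supDensity s t f) (hg : 0 < supDensity s t g) :
    supDensity s t (tensor f g) = supDensity s t f * supDensity s t g := by
  have hm : 0 < Fintype.card ι := card_pos_of_isNorm_rpow hN
  refine (supDensity_tensor_le s t f g).antisymm ?_
  rw [← supNorm_pow s t hm f, ← supNorm_pow s t hm g, ← supNorm_pow s t hm (tensor f g), ← mul_pow]
  refine pow_le_pow_left₀ (mul_nonneg (supNorm_nonneg s t f) (supNorm_nonneg s t g)) ?_ _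
  have hf' : 0 < supNorm s t f := Real.rpow_pos_of_pos hf _
  have hg' : 0 < supNorm s t g := Real.rpow_pos_of_pos hg _
  obtain ⟨c, hc⟩ := exists_eq_supDensity s t f
  obtain ⟨d, hd⟩ := exists_eq_supDensity s t g
  obtain ⟨j⟩ : Nonempty ι := Fintype.card_pos_iff.1 hm
  by_cases hj : c j = d j
  · exact supNorm_mul_le_tensor_of_eq s t hN hf' hg' hj hc hd
  -- Flipping every colour of d conjugates the density, so the flipped colouring is still maximal
  -- and now agrees with c at j.
  · refine supNorm_mul_le_tensor_of_eq s t hN hf' hg' (d := fun i => !(d i)) (j := j) ?_ hc ?_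
    · revert hj
      cases c j <;> cases d j <;> simp
    · simp only [colour_not]
      rw [density_conj, RCLike.norm_conj, hd]

/-- A single 2-edge-colouring attains the maximum for all functions simultaneously. -/
theorem exists_colouring_eq_supDensity (hN : IsNorm ℝ (realNorm s t)) :
    ∃ c : ι → Bool, ∀ f, ‖density s t fun i => colour (c i) f‖ = supDensity s t f := by
  classical
  by_contra! hne
  have hlt : ∀ c : ι → Bool, ∃ f, ‖density s t fun i => colour (c i) f‖ < supDensity s t f :=
    fun c => (hne c).imp fun f hf => (le_supDensity s t c f).lt_of_ne hf
  -- One function defeats all colourings in S: each new counterexample is tensored on, and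
  -- strictness in either factor survives in the product.
  have key : ∀ S : Finset (ι → Bool), ∃ f, 0 < supDensity s t f ∧
      ∀ c ∈ S, ‖density s t fun i => colour (c i) f‖ < supDensity s t f := fun S => by
    induction S using Finset.induction_on with
    | empty =>
      refine ⟨one, ?_, by simp⟩
      have := le_supDensity s t (fun _ => true) one
      simp only [colour_one, density_one, norm_one] at this
      linarith
    | insert a S _ ih =>
      obtain ⟨F, hF, hS⟩ := ih
      obtain ⟨g, hg⟩ := hlt a
      have hg0 : 0 < supDensity s t g := (norm_nonneg _).trans_lt hg
      refine ⟨tensor F g, ?_, fun c hc => ?_⟩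
      · rw [supDensity_tensor s t hN hF hg0]
        positivity
      · rw [supDensity_tensor s t hN hF hg0]
        simp only [colour_tensor]
        rw [density_tensor, norm_mul]
        rcases Finset.mem_insert.1 hc with rfl | hc
        · exact mul_lt_mul' (le_supDensity s t _ F) hg (norm_nonneg _) hF
        · exact (mul_le_mul_of_nonneg_left (le_supDensity s t _ g) (norm_nonneg _)).trans_lt
            (mul_lt_mul_of_pos_right (hS c hc) hg0)
  obtain ⟨f, -, hf⟩ := key Finset.univ
  obtain ⟨c, hc⟩ := exists_eq_supDensity s t f
  exact (hf c (Finset.mem_univ c)).ne hc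

theorem isNorm_realNorm_of_eq {N : BddMeas ℂ → ℝ} (hN : IsNorm ℂ N)
    (h : ∀ f, N (ofReal f) = realNorm s t f) : IsNorm ℝ (realNorm s t) where
  add_le f g := by
    rw [← h, ← h, ← h, ofReal_add]
    exact hN.add_le _ _
  smul_eq c f := by
    rw [← h, ← h, ofReal_smul, hN.smul_eq, Complex.norm_real]
  eq_zero_iff f := by
    rw [← h, hN.eq_zero_iff]
    refine Filter.eventually_congr (.of_forall fun z => ?_)
    exact Complex.ofReal_eq_zero

end Norm

/-! ### Transfer to bipartite graphs -/

section Graph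

variable {V : Type*} [Fintype V] [DecidableEq V] {H : SimpleGraph V} [DecidableRel H.Adj]
  {A B : Finset V}

theorem dart_edge_bijective (hH : H.IsBipartiteWith (A : Set V) (B : Set V)) :
    Function.Bijective fun d : orientedEdges H A => (⟨d.1.edge, d.1.edge_mem⟩ : H.edgeSet) := by
  have hdis : ∀ v, v ∈ A → v ∈ B → False := fun v ha hb =>
    Set.disjoint_left.1 hH.disjoint ha hb
  constructor
  · rintro ⟨d, hd⟩ ⟨d', hd'⟩ h
    have hd : d.fst ∈ A := (Finset.mem_filter.1 hd).2
    have hd' : d'.fst ∈ A := (Finset.mem_filter.1 hd').2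
    rcases SimpleGraph.dart_edge_eq_iff d d' |>.1 (congrArg Subtype.val h) with h | h
    · exact Subtype.ext h
    -- Two opposite darts starting in A would put both ends of an edge in A.
    · exfalso
      subst h
      rcases hH.mem_of_adj d'.adj with h1 | h1
      · exact hdis _ hd h1.2
      · exact hdis _ hd' h1.1
  · rintro ⟨e, he⟩
    induction e using Sym2.ind with
    | _ u v =>
      rcases hH.mem_of_adj he with h1 | h1
      · exact ⟨⟨⟨(u, v), he⟩, by simpa [orientedEdges] using h1.1⟩, rfl⟩
      · exact ⟨⟨⟨(v, u), SimpleGraph.Adj.symm he⟩, by simpa [orientedEdges] using h1.2⟩,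
          Subtype.ext Sym2.eq_swap⟩

/-- The oriented edges of a bipartite graph correspond to its edges. -/
def orientedEdgesEquiv (hH : H.IsBipartiteWith (A : Set V) (B : Set V)) :
    orientedEdges H A ≃ H.edgeSet :=
  Equiv.ofBijective _ (dart_edge_bijective hH)

theorem card_orientedEdges (hH : H.IsBipartiteWith (A : Set V) (B : Set V)) :
    H.edgeFinset.card = Fintype.card (orientedEdges H A) := by
  rw [SimpleGraph.edgeFinset_card, Fintype.card_congr (orientedEdgesEquiv hH)]

theorem realDensity_eq (f : BddMeas ℝ) :
    (realDensity H A f : ℂ) = density (fun d : orientedEdges H A => d.1.fst) (fun d => d.1.snd)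
      fun _ => ofReal f := by
  unfold realDensity density
  rw [← integral_complex_ofReal]
  refine integral_congr_ae (.of_forall fun x => ?_)
  change ((∏ d ∈ orientedEdges H A, f.1 (x d.fst, x d.snd) : ℝ) : ℂ) = _
  rw [Complex.ofReal_prod, ← Finset.prod_coe_sort]
  rfl

theorem colouredDensity_eq (hH : H.IsBipartiteWith (A : Set V) (B : Set V)) (α : H.edgeSet → Bool)
    (f : BddMeas ℂ) :
    colouredDensity H A α f = density (fun d : orientedEdges H A => d.1.fst) (fun d => d.1.snd)
      fun d => colour (α (orientedEdgesEquiv hH d)) f := by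
  unfold colouredDensity density
  refine integral_congr_ae (.of_forall fun x => ?_)
  beta_reduce
  rw [← Finset.prod_coe_sort]
  refine Finset.prod_congr rfl fun d _ => ?_
  change (if α (orientedEdgesEquiv hH d) = true then _ else _) = _
  cases α (orientedEdgesEquiv hH d) <;> rfl

theorem maxDensity_eq (hH : H.IsBipartiteWith (A : Set V) (B : Set V)) (f : BddMeas ℂ) :
    maxDensity H A f =
      supDensity (fun d : orientedEdges H A => d.1.fst) (fun d => d.1.snd) f := by
  unfold maxDensity supDensity
  refine Equiv.iSup_congr ((orientedEdgesEquiv hH).symm.arrowCongr (Equiv.refl Bool)) fun α => ?_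
  rw [colouredDensity_eq hH]
  simp [Equiv.arrowCongr]

theorem realNorming_iff (hH : H.IsBipartiteWith (A : Set V) (B : Set V)) :
    RealNorming H A ↔
      IsNorm ℝ (realNorm (fun d : orientedEdges H A => d.1.fst) fun d => d.1.snd) := by
  unfold RealNorming
  refine iff_of_eq (congrArg _ (funext fun f => ?_))
  rw [realNorm, ← realDensity_eq, Complex.norm_real, Real.norm_eq_abs, card_orientedEdges hH]

theorem maxNorming_iff (hH : H.IsBipartiteWith (A : Set V) (B : Set V)) :
    MaxNorming H A ↔
      IsNorm ℂ (supNorm (fun d : orientedEdges H A => d.1.fst) fun d => d.1.snd) := by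
  unfold MaxNorming
  refine iff_of_eq (congrArg _ (funext fun f => ?_))
  rw [supNorm, ← maxDensity_eq hH, card_orientedEdges hH]

theorem realNorming_of_maxNorming (hH : H.IsBipartiteWith (A : Set V) (B : Set V))
    (h : MaxNorming H A) : RealNorming H A :=
  (realNorming_iff hH).2 (isNorm_realNorm_of_eq _ _ ((maxNorming_iff hH).1 h)
    (supNorm_ofReal _ _))

theorem maxNorming_of_realNorming (hH : H.IsBipartiteWith (A : Set V) (B : Set V))
    (h : RealNorming H A) : MaxNorming H A :=
  (maxNorming_iff hH).2 (isNorm_supNorm _ _ ((realNorming_iff hH).1 h))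

theorem realNorming_of_complexNorming (hH : H.IsBipartiteWith (A : Set V) (B : Set V))
    (h : ComplexNorming H A) : RealNorming H A := by
  obtain ⟨α, hα⟩ := h
  refine (realNorming_iff hH).2 (isNorm_realNorm_of_eq _ _ hα fun f => ?_)
  simp only [colouredDensity_eq hH, colour_ofReal, realNorm, card_orientedEdges hH]

theorem complexNorming_of_realNorming (hH : H.IsBipartiteWith (A : Set V) (B : Set V))
    (h : RealNorming H A) : ComplexNorming H A := by
  have hN := (realNorming_iff hH).1 h
  obtain ⟨c, hc⟩ := exists_colouring_eq_supDensity _ _ hN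
  refine ⟨c ∘ (orientedEdgesEquiv hH).symm, ?_⟩
  have hS := isNorm_supNorm _ _ hN
  unfold ColouredComplexNorming
  convert hS using 2 with f
  simp only [colouredDensity_eq hH, Function.comp_apply, Equiv.symm_apply_apply, hc, supNorm,
    card_orientedEdges hH]

end Graph

end GraphNorm

end

theorem theorem1p1 {V : Type*} [Fintype V] [DecidableEq V] (H : SimpleGraph V)
    [DecidableRel H.Adj] (A B : Finset V) (hH : H.IsBipartiteWith (A : Set V) (B : Set V)) :
    (GraphNorm.ComplexNorming H A ↔ GraphNorm.RealNorming H A) ∧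
      [GraphNorm.RealNorming H A, GraphNorm.MaxNorming H A, GraphNorm.ComplexNorming H A].TFAE := by
  refine ⟨⟨GraphNorm.realNorming_of_complexNorming hH,
    GraphNorm.complexNorming_of_realNorming hH⟩, ?_⟩
  tfae_have 1 → 2 := GraphNorm.maxNorming_of_realNorming hH
  tfae_have 2 → 1 := GraphNorm.realNorming_of_maxNorming hH
  tfae_have 1 → 3 := GraphNorm.complexNorming_of_realNorming hH
  tfae_have 3 → 1 := GraphNorm.realNorming_of_complexNorming hH
  tfae_finish
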